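/- A \emph{cartesian closed 2-category} is a strict 2-category $K$ with a terminal object $1$, binary products $A\times B$ and exponentials $A^J$ such that, for all objects $X, A, B, J$, the hom-category $K(X,1)$ is the terminal category and the canonical functors $K(X,A\times B)\to K(X,A)\times K(X,B)$ and $K(X,A^J)\to K(X\times J,A)$ (given by the projections and by $h\mapsto \mathrm{ev}\circ(h\times J)$) are isomorphisms of categories. Write $u^J\colon A^J\to B^J$ for exponentiation of $u\colon A\to B$, and $\Delta\colon A\cong A^1\to A^J$ for exponentiation with $!\colon J\to 1$; then $u^J\Delta=\Delta u$. A pair $(r,\rho)$ with $r\colon C\to B$ and $\rho\colon fr\Rightarrow g$ is an \emph{absolute right lifting} of $g\colon C\to A$ through $f\colon B\to A$ if for all $b\colon X\to B$ and $c\colon X\to C$ pasting with $\rho$, $\beta\mapsto \rho c\cdot f\beta$, is a bijection from 2-cells $b\Rightarrow rc$ to 2-cells $fb\Rightarrow gc$; absolute left liftings $(l,\gamma\colon g\Rightarrow fl)$ are defined dually, by reversing 2-cells. A \emph{limit cone} of a diagram $d\colon 1\to A^J$ is an absolute right lifting $(\ell\colon 1\to A,\ \lambda\colon\Delta\ell\Rightarrow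 d)$ of $d$ through $\Delta$, and a \emph{colimit cone} is an absolute left lifting $(c\colon 1\to A,\ \gamma\colon d\Rightarrow\Delta c)$ of $d$ through $\Delta$. \textbf{Theorem.} Let $K$ be a cartesian closed 2-category, and let $f\colon B\to A$ and $u\colon A\to B$ be 1-cells of $K$ with $f$ left adjoint to $u$. Then for every object $J$: (1) if $(\ell,\lambda)$ is a limit cone of $d\colon 1\to A^J$, then $(u\ell,\ u^J\lambda\colon \Delta u\ell=u^J\Delta\ell\Rightarrow u^Jd)$ is a limit cone of $u^Jd$; (2) if $(c,\gamma)$ is a colimit cone of $d\colon 1\to B^J$, then $(fc,\ f^J\gamma\colon f^Jd\Rightarrow f^J\Delta c=\Delta fc)$ is a colimit cone of $f^Jd$. In particular this holds in the 2-category $\infty\text{-}\mathsf{CAT}$ of $\infty$-categories, in the model whose objects are the quasi-categories, whose 1-cells are the maps of simplicial sets, and whose hom-category from $X$ to $Y$ is the homotopy category of the quasi-category $Y^X$, with products and exponentials those of simplicial sets: right adjoints between $\infty$-categories preserve limits, and left adjoints preserve colimits. -/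

import Mathlib

open CategoryTheory Bicategory

universe t w v u

/-! ### Absolute liftings in a 2-category -/

section Lifting

variable {K : Type u} [Bicategory.{w, v} K] {A B C : K}

/-- `(r, ρ)`, with `ρ : f r ⇒ g`, is an absolute right lifting of `g : C ⟶ A` through `f : B ⟶ A`
(a right adjoint of `f` relative to `g`): for all `b : X ⟶ B` and `c : X ⟶ C`, pasting with `ρ` is a
bijection from 2-cells `β : b ⇒ r c` to 2-cells `α : f b ⇒ g c`.
(Composites are written in diagrammatic order.) -/
def IsAbsoluteRightLifting (f : B ⟶ A) (g : C ⟶ A) (r : C ⟶ B) (ρ : r ≫ f ⟶ g) : Prop :=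
  ∀ ⦃X : K⦄ (b : X ⟶ B) (c : X ⟶ C),
    Function.Bijective fun β : b ⟶ c ≫ r => (β ▷ f ≫ (α_ c r f).hom ≫ c ◁ ρ : b ≫ f ⟶ c ≫ g)

/-- `(l, γ)`, with `γ : g ⇒ f l`, is an absolute left lifting of `g : C ⟶ A` through `f : B ⟶ A`
(a left adjoint of `f` relative to `g`): for all `b : X ⟶ B` and `c : X ⟶ C`, pasting with `γ` is a
bijection from 2-cells `β : l c ⇒ b` to 2-cells `α : g c ⇒ f b`. -/
def IsAbsoluteLeftLifting (f : B ⟶ A) (g : C ⟶ A) (l : C ⟶ B) (γ : g ⟶ l ≫ f) : Prop :=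
  ∀ ⦃X : K⦄ (b : X ⟶ B) (c : X ⟶ C),
    Function.Bijective fun β : c ≫ l ⟶ b => (c ◁ γ ≫ (α_ c l f).inv ≫ β ▷ f : c ≫ g ⟶ b ≫ f)

end Lifting

/-! ### Cartesian closed 2-categories -/

/-- A (strict) 2-category with chosen finite 2-products: a terminal object `one` and binary products
`prod A B`, the hom-category `K(X, one)` being the terminal category, and the functor
`K(X, prod A B) ⥤ K(X, A) × K(X, B)` given by the projections being an isomorphism of categories
(bijective on 1-cells and on 2-cells). -/
class CartesianTwoCategory (K : Type u) [Bicategory.{w, v} K] [Bicategory.Strict K] where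
  one : K
  toOne (X : K) : X ⟶ one
  toOne_unique {X : K} (h : X ⟶ one) : h = toOne X
  toOne_unique₂ {X : K} {h k : X ⟶ one} (θ θ' : h ⟶ k) : θ = θ'
  prod : K → K → K
  fst (A B : K) : prod A B ⟶ A
  snd (A B : K) : prod A B ⟶ B
  pair_bijective (X A B : K) :
    Function.Bijective fun h : X ⟶ prod A B => (h ≫ fst A B, h ≫ snd A B)
  pair₂_bijective {X A B : K} (h k : X ⟶ prod A B) :
    Function.Bijective fun θ : h ⟶ k => (θ ▷ fst A B, θ ▷ snd A B)

namespace CartesianTwoCategory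

variable {K : Type u} [Bicategory.{w, v} K] [Bicategory.Strict K] [CartesianTwoCategory K]

/-- The 1-cell `(p, q) : X ⟶ A × B`. -/
noncomputable def lift {X A B : K} (p : X ⟶ A) (q : X ⟶ B) : X ⟶ prod A B :=
  ((pair_bijective X A B).2 (p, q)).choose

theorem lift_fst {X A B : K} (p : X ⟶ A) (q : X ⟶ B) : lift p q ≫ fst A B = p :=
  congrArg Prod.fst ((pair_bijective X A B).2 (p, q)).choose_spec

theorem lift_snd {X A B : K} (p : X ⟶ A) (q : X ⟶ B) : lift p q ≫ snd A B = q :=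
  congrArg Prod.snd ((pair_bijective X A B).2 (p, q)).choose_spec

theorem prod_hom_ext {X A B : K} {h k : X ⟶ prod A B} (h₁ : h ≫ fst A B = k ≫ fst A B)
    (h₂ : h ≫ snd A B = k ≫ snd A B) : h = k :=
  (pair_bijective X A B).1 (Prod.ext h₁ h₂)

/-- The 2-cell `h ⇒ k` between 1-cells into `A × B` with prescribed components. -/
noncomputable def lift₂ {X A B : K} {h k : X ⟶ prod A B} (α : h ≫ fst A B ⟶ k ≫ fst A B)
    (β : h ≫ snd A B ⟶ k ≫ snd A B) : h ⟶ k :=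
  ((pair₂_bijective h k).2 (α, β)).choose

theorem lift₂_fst {X A B : K} {h k : X ⟶ prod A B} (α : h ≫ fst A B ⟶ k ≫ fst A B)
    (β : h ≫ snd A B ⟶ k ≫ snd A B) : lift₂ α β ▷ fst A B = α :=
  congrArg Prod.fst ((pair₂_bijective h k).2 (α, β)).choose_spec

theorem lift₂_snd {X A B : K} {h k : X ⟶ prod A B} (α : h ≫ fst A B ⟶ k ≫ fst A B)
    (β : h ≫ snd A B ⟶ k ≫ snd A B) : lift₂ α β ▷ snd A B = β :=
  congrArg Prod.snd ((pair₂_bijective h k).2 (α, β)).choose_spec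

/-- The 1-cell `h × J`. -/
noncomputable def prodMap {X Y : K} (h : X ⟶ Y) (J : K) : prod X J ⟶ prod Y J :=
  lift (fst X J ≫ h) (snd X J)

theorem prodMap_fst {X Y : K} (h : X ⟶ Y) (J : K) : prodMap h J ≫ fst Y J = fst X J ≫ h :=
  lift_fst _ _

theorem prodMap_snd {X Y : K} (h : X ⟶ Y) (J : K) : prodMap h J ≫ snd Y J = snd X J :=
  lift_snd _ _

/-- The 2-cell `θ × J : h × J ⇒ k × J`. -/
noncomputable def prodMap₂ {X Y : K} {h k : X ⟶ Y} (θ : h ⟶ k) (J : K) :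
    prodMap h J ⟶ prodMap k J :=
  lift₂ (eqToHom (prodMap_fst h J) ≫ fst X J ◁ θ ≫ eqToHom (prodMap_fst k J).symm)
    (eqToHom ((prodMap_snd h J).trans (prodMap_snd k J).symm))

theorem prodMap₂_fst {X Y : K} {h k : X ⟶ Y} (θ : h ⟶ k) (J : K) :
    prodMap₂ θ J ▷ fst Y J =
      eqToHom (prodMap_fst h J) ≫ fst X J ◁ θ ≫ eqToHom (prodMap_fst k J).symm :=
  lift₂_fst _ _

theorem prodMap₂_snd {X Y : K} {h k : X ⟶ Y} (θ : h ⟶ k) (J : K) :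
    prodMap₂ θ J ▷ snd Y J = eqToHom ((prodMap_snd h J).trans (prodMap_snd k J).symm) :=
  lift₂_snd _ _

end CartesianTwoCategory

section

open CartesianTwoCategory

/-- A cartesian closed 2-category: a 2-category with finite 2-products and with exponentials
`exp J A`, written `A^J`; the functor `K(X, A^J) ⥤ K(X × J, A)`, `h ↦ ev ∘ (h × J)`, is an
isomorphism of categories (bijective on 1-cells and on 2-cells). -/
class CartesianClosedTwoCategory (K : Type u) [Bicategory.{w, v} K] [Bicategory.Strict K] extends
    CartesianTwoCategory K where
  exp : K → K → K
  ev (J A : K) : prod (exp J A) J ⟶ A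
  curry_bijective (X J A : K) :
    Function.Bijective fun h : X ⟶ exp J A => prodMap h J ≫ ev J A
  curry₂_bijective {X J A : K} (h k : X ⟶ exp J A) :
    Function.Bijective fun θ : h ⟶ k => prodMap₂ θ J ▷ ev J A

namespace CartesianClosedTwoCategory

variable {K : Type u} [Bicategory.{w, v} K] [Bicategory.Strict K] [CartesianClosedTwoCategory K]

/-- The transpose `X ⟶ A^J` of a 1-cell `X × J ⟶ A`. -/
noncomputable def curry {X J A : K} (g : prod X J ⟶ A) : X ⟶ exp J A :=
  ((curry_bijective X J A).2 g).choose

theorem prodMap_curry_ev {X J A : K} (g : prod X J ⟶ A) : prodMap (curry g) J ≫ ev J A = g :=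
  ((curry_bijective X J A).2 g).choose_spec

/-- Exponentiation of `u : A ⟶ B` by `J`: the 1-cell `u^J : A^J ⟶ B^J`. -/
noncomputable def expMap {A B : K} (u : A ⟶ B) (J : K) : exp J A ⟶ exp J B :=
  curry (ev J A ≫ u)

/-- Exponentiation with `m : I ⟶ J`: the 1-cell `A^m : A^J ⟶ A^I`. -/
noncomputable def expPre {I J : K} (m : I ⟶ J) (A : K) : exp J A ⟶ exp I A :=
  curry (lift (fst (exp J A) I) (snd (exp J A) I ≫ m) ≫ ev J A)

/-- The constant diagrams 1-cell `Δ : A ≅ A^1 ⟶ A^J`, exponentiation with `! : J ⟶ 1`. -/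
noncomputable def constDiagram (A J : K) : A ⟶ exp J A :=
  curry (fst A one) ≫ expPre (toOne J) A

theorem prodMap_comp {X Y Z : K} (h : X ⟶ Y) (k : Y ⟶ Z) (J : K) :
    prodMap (h ≫ k) J = prodMap h J ≫ prodMap k J := by
  apply prod_hom_ext
  · rw [Strict.assoc]
    simp only [prodMap, lift_fst]
    rw [← Strict.assoc, ← Strict.assoc, lift_fst]
  · rw [Strict.assoc]
    simp only [prodMap, lift_snd]

theorem exp_hom_ext {X J A : K} {h k : X ⟶ exp J A}
    (e : prodMap h J ≫ ev J A = prodMap k J ≫ ev J A) : h = k :=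
  (curry_bijective X J A).1 e

/-- The constant diagrams 1-cell is the transpose of the projection `A × J ⟶ A`. -/
theorem constDiagram_eq (A J : K) : constDiagram A J = curry (fst A J) := by
  apply exp_hom_ext
  rw [prodMap_curry_ev, constDiagram, prodMap_comp, Strict.assoc, expPre, prodMap_curry_ev,
    ← Strict.assoc]
  have : prodMap (curry (fst A one)) J ≫
      lift (fst (exp one A) J) (snd (exp one A) J ≫ toOne J) =
      lift (fst A J) (toOne _) ≫ prodMap (curry (fst A one)) one := by
    apply prod_hom_ext
    · rw [Strict.assoc, Strict.assoc, lift_fst, prodMap, prodMap, lift_fst, lift_fst,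
        ← Strict.assoc, lift_fst]
    · rw [toOne_unique (_ ≫ snd _ one), toOne_unique ((_ ≫ _) ≫ snd _ one)]
  rw [this, Strict.assoc, prodMap_curry_ev, lift_fst]

/-- `u^J Δ = Δ u`. -/
theorem comp_constDiagram {A B : K} (u : A ⟶ B) (J : K) :
    u ≫ constDiagram B J = constDiagram A J ≫ expMap u J := by
  apply exp_hom_ext
  rw [constDiagram_eq, constDiagram_eq, prodMap_comp, prodMap_comp, Strict.assoc, Strict.assoc,
    expMap, prodMap_curry_ev, prodMap_curry_ev, ← Strict.assoc, prodMap_curry_ev, prodMap, lift_fst]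

/-! ### Limits and colimits of diagrams `d : 1 ⟶ A^J` -/

/-- `ℓ : 1 ⟶ A` with the cone `lam : Δ ℓ ⇒ d` is a limit of the diagram `d : 1 ⟶ A^J`. -/
def IsLimitCone {A J : K} (d : one ⟶ exp J A) (ℓ : one ⟶ A) (lam : ℓ ≫ constDiagram A J ⟶ d) :
    Prop :=
  IsAbsoluteRightLifting (constDiagram A J) d ℓ lam

/-- `c : 1 ⟶ A` with the cocone `γ : d ⇒ Δ c` is a colimit of the diagram `d : 1 ⟶ A^J`. -/
def IsColimitCone {A J : K} (d : one ⟶ exp J A) (c : one ⟶ A) (γ : d ⟶ c ≫ constDiagram A J) :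
    Prop :=
  IsAbsoluteLeftLifting (constDiagram A J) d c γ

/-- The image `Δ (u ℓ) = u^J Δ ℓ ⇒ u^J d` under `u : A ⟶ B` of a cone `lam : Δ ℓ ⇒ d`. -/
noncomputable def mapCone {A B J : K} (u : A ⟶ B) {d : one ⟶ exp J A} {ℓ : one ⟶ A}
    (lam : ℓ ≫ constDiagram A J ⟶ d) : (ℓ ≫ u) ≫ constDiagram B J ⟶ d ≫ expMap u J :=
  (α_ ℓ u (constDiagram B J)).hom ≫ ℓ ◁ eqToHom (comp_constDiagram u J) ≫
    (α_ ℓ (constDiagram A J) (expMap u J)).inv ≫ lam ▷ expMap u J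

/-- The image `u^J d ⇒ u^J Δ c = Δ (u c)` under `u : A ⟶ B` of a cocone `γ : d ⇒ Δ c`. -/
noncomputable def mapCocone {A B J : K} (u : A ⟶ B) {d : one ⟶ exp J A} {c : one ⟶ A}
    (γ : d ⟶ c ≫ constDiagram A J) : d ≫ expMap u J ⟶ (c ≫ u) ≫ constDiagram B J :=
  γ ▷ expMap u J ≫ (α_ c (constDiagram A J) (expMap u J)).hom ≫
    c ◁ eqToHom (comp_constDiagram u J).symm ≫ (α_ c u (constDiagram B J)).inv

/-- `u : A ⟶ B` preserves limits: it carries every limit cone over a diagram `d : 1 ⟶ A^J`, of any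
shape `J`, to a limit cone over `u^J d`. -/
def PreservesLimitCones {A B : K} (u : A ⟶ B) : Prop :=
  ∀ (J : K) (d : one ⟶ exp J A) (ℓ : one ⟶ A) (lam : ℓ ≫ constDiagram A J ⟶ d),
    IsLimitCone d ℓ lam → IsLimitCone (d ≫ expMap u J) (ℓ ≫ u) (mapCone u lam)

/-- `u : A ⟶ B` preserves colimits: it carries every colimit cocone under a diagram `d : 1 ⟶ A^J`,
of any shape `J`, to a colimit cocone under `u^J d`. -/
def PreservesColimitCones {A B : K} (u : A ⟶ B) : Prop :=
  ∀ (J : K) (d : one ⟶ exp J A) (c : one ⟶ A) (γ : d ⟶ c ≫ constDiagram A J),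
    IsColimitCone d c γ → IsColimitCone (d ≫ expMap u J) (c ≫ u) (mapCocone u γ)

end CartesianClosedTwoCategory

end


/-! ### The cartesian closed 2-category of `∞`-categories

The objects are the quasi-categories, the 1-cells are the simplicial maps, and the hom-category from
`X` to `Y` is the homotopy category of the simplicial set of maps from `X` to `Y`. The facts below
serve only to show that this 2-category is cartesian closed: products and exponentials are those of
simplicial sets. -/

/-- The 2-category `∞-CAT` of `∞`-categories, in the quasi-category model. (A synonym for `QCat`
that carries only the 2-category structure.) -/
def InftyCat : Type (t + 1) := SSet.QCat.{t}

namespace InftyCat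

open SSet CartesianMonoidalCategory MonoidalCategory

instance : Bicategory.{t, t} InftyCat.{t} := QCat.bicategory
instance : Bicategory.Strict InftyCat.{t} := QCat.strictBicategory

theorem quasicategory_tensor (X Y : SSet.{t}) [Quasicategory X] [Quasicategory Y] :
    Quasicategory (X ⊗ Y) where
  hornFilling' n i σ h0 hn := by
    obtain ⟨a, ha⟩ := Quasicategory.hornFilling h0 hn (σ ≫ fst X Y)
    obtain ⟨b, hb⟩ := Quasicategory.hornFilling h0 hn (σ ≫ snd X Y)
    exact ⟨CartesianMonoidalCategory.lift a b, by
      apply CartesianMonoidalCategory.hom_ext <;> simp [ha, hb]⟩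

theorem quasicategory_unit : Quasicategory (𝟙_ SSet.{t}) where
  hornFilling' _ _ _ _ _ := ⟨toUnit _, toUnit_unique _ _⟩

/-- The underlying simplicial set of a quasi-category. -/
abbrev toSSet (X : InftyCat.{t}) : SSet.{t} := ObjectProperty.FullSubcategory.obj X

/-- The simplicial map underlying a 1-cell. -/
abbrev mapSet {X Y : InftyCat.{t}} (f : X ⟶ Y) : X.toSSet ⟶ Y.toSSet :=
  InducedCategory.Hom.hom f

/-- The 1-cell given by a simplicial map. -/
def ofMap {X Y : InftyCat.{t}} (f : X.toSSet ⟶ Y.toSSet) : X ⟶ Y :=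
  InducedCategory.homMk f

/-- The simplicial set of maps. -/
abbrev sh (X Y : SSet.{t}) : SSet.{t} := EnrichedCategory.Hom (V := SSet.{t}) X Y
/-- Postcomposition with `g`. -/
abbrev post (X : SSet.{t}) {Y Z : SSet.{t}} (g : Y ⟶ Z) : sh X Y ⟶ sh X Z := eHomWhiskerLeft SSet.{t} X g
/-- Precomposition with `g`. -/
abbrev pre {X Y : SSet.{t}} (g : X ⟶ Y) (Z : SSet.{t}) : sh Y Z ⟶ sh X Z := eHomWhiskerRight SSet.{t} g Z

/-- The hom-category, with objects `pt f` and morphisms `base θ`. -/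
abbrev ho (X Y : InftyCat.{t}) : Cat.{t,t} := hoFunctor.obj (sh X.toSSet Y.toSSet)

theorem lax_right {V W : Type*} [Category* V] [Category* W] [MonoidalCategory V]
    [MonoidalCategory W] (F : V ⥤ W) [F.LaxMonoidal] {S T U : V} (f : 𝟙_ V ⟶ T) (c : S ⊗ T ⟶ U) :
    (ρ_ (F.obj S)).inv ≫ F.obj S ◁ (Functor.LaxMonoidal.ε F ≫ F.map f) ≫
      Functor.LaxMonoidal.μ F S T ≫ F.map c = F.map ((ρ_ S).inv ≫ S ◁ f ≫ c) := by
  simp [← Functor.LaxMonoidal.right_unitality_inv_assoc]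

theorem lax_left {V W : Type*} [Category* V] [Category* W] [MonoidalCategory V]
    [MonoidalCategory W] (F : V ⥤ W) [F.LaxMonoidal] {S T U : V} (f : 𝟙_ V ⟶ S) (c : S ⊗ T ⟶ U) :
    (λ_ (F.obj T)).inv ≫ (Functor.LaxMonoidal.ε F ≫ F.map f) ▷ F.obj T ≫
      Functor.LaxMonoidal.μ F S T ≫ F.map c = F.map ((λ_ T).inv ≫ f ▷ T ≫ c) := by
  simp [← Functor.LaxMonoidal.left_unitality_inv_assoc]

theorem post_cat (X Y Z : QCat.{t}) (g : Y ⟶ Z) :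
    eHomWhiskerLeft Cat X g = hoFunctor.map (post X.obj g.hom) :=
  lax_right hoFunctor (eHomEquiv SSet g.hom) (eComp SSet X.obj Y.obj Z.obj)

theorem pre_cat {X Y : QCat.{t}} (g : X ⟶ Y) (Z : QCat.{t}) :
    eHomWhiskerRight Cat g Z = hoFunctor.map (pre g.hom Z.obj) :=
  lax_left hoFunctor (eHomEquiv SSet g.hom) (eComp SSet X.obj Y.obj Z.obj)

/-- The object of the hom-category given by a 1-cell. -/
abbrev pt {X Y : InftyCat.{t}} (f : X ⟶ Y) : ho X Y :=
  CatEnrichedOrdinary.homEquiv (C := QCat.{t}) f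

/-- The morphism of the hom-category given by a 2-cell. -/
def base {X Y : InftyCat.{t}} {f g : X ⟶ Y} (θ : f ⟶ g) : pt f ⟶ pt g :=
  CatEnrichedOrdinary.Hom.base (C := QCat.{t}) θ

theorem base_bijective {X Y : InftyCat.{t}} (f g : X ⟶ Y) :
   Function.Bijective (base : (f ⟶ g) → (pt f ⟶ pt g)) :=
  ⟨fun _ _ h => CatEnrichedOrdinary.Hom.ext (C := QCat.{t}) _ _ h,
   fun α => ⟨CatEnrichedOrdinary.Hom.mk (C := QCat.{t}) α, rfl⟩⟩

theorem base_eqToHom {X Y : InftyCat.{t}} {f g : X ⟶ Y} (h : f = g) :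
   base (eqToHom h) = eqToHom (by rw [h]) := by subst h; rfl
theorem base_comp {X Y : InftyCat.{t}} {f g h : X ⟶ Y} (α : f ⟶ g) (β : g ⟶ h) :
   base (α ≫ β) = base α ≫ base β := rfl

theorem pt_post {X Y Z : InftyCat.{t}} (f : X ⟶ Y) (g : Y ⟶ Z) :
    pt (f ≫ g) = (hoFunctor.map (post X.toSSet (mapSet g))).toFunctor.obj (pt f) := by
  rw [← post_cat X Y Z g]
  exact CatEnrichedOrdinary.homEquiv_comp (C := QCat.{t}) f g
theorem pt_pre {X Y Z : InftyCat.{t}} (f : X ⟶ Y) (g : Y ⟶ Z) :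
    pt (f ≫ g) = (hoFunctor.map (pre (mapSet f) Z.toSSet)).toFunctor.obj (pt g) := by
  rw [← pre_cat (X := X) (Y := Y) f Z]
  exact CatEnrichedOrdinary.homEquiv_comp (C := QCat.{t}) f g

theorem base_post {X Y Z : InftyCat.{t}} {f f' : X ⟶ Y} (θ : f ⟶ f') (g : Y ⟶ Z) :
    base (θ ▷ g) = eqToHom (pt_post f g) ≫
      (hoFunctor.map (post X.toSSet (mapSet g))).toFunctor.map (base θ) ≫
      eqToHom (pt_post f' g).symm := by
  have := Functor.congr_hom (congrArg Cat.Hom.toFunctor (post_cat X Y Z g).symm) (base θ)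
  rw [this]
  simp only [Category.assoc, eqToHom_trans, eqToHom_trans_assoc]
  rfl
theorem base_pre {X Y Z : InftyCat.{t}} (f : X ⟶ Y) {g g' : Y ⟶ Z} (θ : g ⟶ g')  :
    base (f ◁ θ) = eqToHom (pt_pre f g) ≫
      (hoFunctor.map (pre (mapSet f) Z.toSSet)).toFunctor.map (base θ) ≫
      eqToHom (pt_pre f g').symm := by
  have := Functor.congr_hom (congrArg Cat.Hom.toFunctor (pre_cat (X := X) (Y := Y) f Z).symm) (base θ)
  rw [this]
  simp only [Category.assoc, eqToHom_trans, eqToHom_trans_assoc]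
  rfl


theorem heq_base_post {X Y Z : InftyCat.{t}} {f f' : X ⟶ Y} (θ : f ⟶ f') (g : Y ⟶ Z) :
    base (θ ▷ g) ≍ (hoFunctor.map (post X.toSSet (mapSet g))).toFunctor.map (base θ) := by
  rw [base_post]; simp

theorem heq_base_pre {X Y Z : InftyCat.{t}} (f : X ⟶ Y) {g g' : Y ⟶ Z} (θ : g ⟶ g') :
    base (f ◁ θ) ≍ (hoFunctor.map (pre (mapSet f) Z.toSSet)).toFunctor.map (base θ) := by
  rw [base_pre]; simp

/-- The simplicial map `h ↦ h × J`. -/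
def sprod (X J Y : SSet.{t}) : sh X Y ⟶ sh (X ⊗ J) (Y ⊗ J) where
  app n := TypeCat.ofHom fun a =>
    ({ app := fun c φ => a.app c φ ▷ J.obj c
       naturality := fun {c d} f φ => by
        ext ⟨x, j⟩
        have e := ConcreteCategory.congr_hom (a.naturality f φ) x
        exact Prod.ext e rfl } :
      Functor.HomObj (X ⊗ J) (Y ⊗ J) _)
  naturality := by intros; rfl

/-- Maps into a product of simplicial sets are pairs of maps. -/
def pairIso (X A B : SSet.{t}) : sh X (A ⊗ B) ≅ sh X A ⊗ sh X B where
  hom := CartesianMonoidalCategory.lift (post X (fst A B)) (post X (snd A B))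
  inv := { app := fun n => TypeCat.ofHom fun p =>
            ({app := fun c φ => CartesianMonoidalCategory.lift (p.1.app c φ) (p.2.app c φ)
              naturality := fun {c d} f φ => by
                ext x
                have e₁ := ConcreteCategory.congr_hom (p.1.naturality f φ) x
                have e₂ := ConcreteCategory.congr_hom (p.2.naturality f φ) x
                exact Prod.ext e₁ e₂ } : Functor.HomObj X (A ⊗ B) _)
           naturality := by intros; rfl }
  hom_inv_id := by ext; rfl
  inv_hom_id := by ext <;> rfl

/-- Evaluation of the exponential `A^J` of simplicial sets. -/
def sev (J A : SSet.{t}) : (ihom J).obj A ⊗ J ⟶ A := (β_ _ _).hom ≫ (ihom.ev J).app A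

/-- Transposition of simplicial maps, an isomorphism of simplicial sets of maps. -/
def expIso (X J A : SSet.{t}) : sh X ((ihom J).obj A) ≅ sh (X ⊗ J) A where
  hom := sprod X J _ ≫ post (X ⊗ J) (sev J A)
  inv := { app := fun n => TypeCat.ofHom fun b =>
            ({app := fun c φ => TypeCat.ofHom fun x =>
                ({ app := fun d ψ => TypeCat.ofHom fun j => b.app d (φ ≫ ψ) (X.map ψ x, j)
                   naturality := fun {d d'} g ψ => by
                    ext j
                    have e := ConcreteCategory.congr_hom (b.naturality g (φ ≫ ψ))
                      (show (X ⊗ J).obj d from ((X.map ψ x, j) : X.obj d × J.obj d))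
                    have e' : b.app d' (φ ≫ ψ ≫ g) (X.map (ψ ≫ g) x, J.map g j) =
                      b.app d' ((φ ≫ ψ) ≫ g) (X.map g (X.map ψ x), J.map g j) := by
                      rw [Category.assoc, X.map_comp]; rfl
                    exact e'.trans e } : Functor.HomObj J A _)
              naturality := fun {c d} f φ => by
                ext x
                refine Functor.functorHom_ext fun Y ψ => ?_
                ext j
                have e' : b.app Y ((φ ≫ f) ≫ ψ) (X.map ψ (X.map f x), j) =
                      b.app Y (φ ≫ f ≫ ψ) (X.map (f ≫ ψ) x, j) := by
                      rw [Category.assoc, X.map_comp]; rfl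
                exact e' } : Functor.HomObj X ((ihom J).obj A) _)
           naturality := fun n m f => by
            ext b
            refine Functor.functorHom_ext fun c φ => ?_
            ext x
            refine Functor.functorHom_ext fun d ψ => ?_
            ext j
            have e' : b.app d (f ≫ φ ≫ ψ) (X.map ψ x, j) =
                      b.app d ((f ≫ φ) ≫ ψ) (X.map ψ x, j) := by
                      rw [Category.assoc]
            exact e' }
  hom_inv_id := by
    ext n a
    refine Functor.functorHom_ext fun c φ => ?_
    ext x
    refine Functor.functorHom_ext fun d ψ => ?_
    ext j
    have e := congrArg (fun z : (sh J A).obj d => z.app d (𝟙 d) j) (ConcreteCategory.congr_hom (a.naturality ψ φ) x)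
    have e' : (a.app c φ x).app d (ψ ≫ 𝟙 d) j = (a.app c φ x).app d ψ j := by rw [Category.comp_id]
    exact e.trans e'
  inv_hom_id := by
    ext n b
    refine Functor.functorHom_ext fun c φ => ?_
    ext ⟨x, j⟩
    have e : b.app c (φ ≫ 𝟙 c) (X.map (𝟙 c) x, j) = b.app c φ (x, j) := by
      rw [Category.comp_id, X.map_id]; rfl
    exact e

theorem bijective_of_isIso_lift {C D E : Cat.{t, t}} (F : C ⟶ D) (G : C ⟶ E)
    [IsIso (CartesianMonoidalCategory.lift F G)] (x y : C) :
    Function.Bijective fun θ : x ⟶ y => (F.toFunctor.map θ, G.toFunctor.map θ) := by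
  have h : (CartesianMonoidalCategory.lift F G).toFunctor.IsEquivalence :=
    (Cat.equivOfIso (asIso (CartesianMonoidalCategory.lift F G))).isEquivalence_functor
  exact ⟨fun a b e => (CartesianMonoidalCategory.lift F G).toFunctor.map_injective e,
    fun p => (CartesianMonoidalCategory.lift F G).toFunctor.map_surjective p⟩

theorem bijective_of_isIso {C D : Cat.{t, t}} (F : C ⟶ D) [IsIso F] (x y : C) :
    Function.Bijective fun θ : x ⟶ y => F.toFunctor.map θ := by
  have h : F.toFunctor.IsEquivalence := (Cat.equivOfIso (asIso F)).isEquivalence_functor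
  exact ⟨fun a b e => F.toFunctor.map_injective e, fun p => F.toFunctor.map_surjective p⟩

theorem isIso_lift_ho (X A B : SSet.{t}) :
    IsIso (CartesianMonoidalCategory.lift (hoFunctor.map (post X (fst A B)))
      (hoFunctor.map (post X (snd A B)))) := by
  have h : CartesianMonoidalCategory.lift (hoFunctor.map (post X (fst A B)))
      (hoFunctor.map (post X (snd A B))) =
      hoFunctor.map (pairIso X A B).hom ≫ prodComparison hoFunctor _ _ := by
    apply CartesianMonoidalCategory.hom_ext <;>
      simp [← Functor.map_comp, pairIso]
  rw [h]
  infer_instance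

theorem bijective_conj {C : Type*} [Category* C] {x x' y y' : C} (h : x' = x) (k : y = y') :
    Function.Bijective fun θ : x ⟶ y => eqToHom h ≫ θ ≫ eqToHom k := by
  subst h k
  simpa using! Function.bijective_id

theorem comp_eq {X Y Z : InftyCat.{t}} (f : X ⟶ Y) (g : Y ⟶ Z) :
    mapSet (f ≫ g) = mapSet f ≫ mapSet g := rfl

theorem map_ext {X Y : InftyCat.{t}} {f g : X ⟶ Y} (h : mapSet f = mapSet g) : f = g :=
  InducedCategory.hom_ext h

/-- The terminal quasi-category. -/
abbrev terminalObj : InftyCat.{t} := (⟨𝟙_ SSet, quasicategory_unit⟩ : QCat.{t})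
/-- The product of quasi-categories. -/
abbrev prodObj (X Y : InftyCat.{t}) : InftyCat.{t} :=
  (⟨X.toSSet ⊗ Y.toSSet,
      have : Quasicategory X.toSSet := ObjectProperty.FullSubcategory.property X
      have : Quasicategory Y.toSSet := ObjectProperty.FullSubcategory.property Y
      quasicategory_tensor _ _⟩ : QCat.{t})
/-- The quasi-category `A^J` of `J`-shaped diagrams in `A`. -/
abbrev expObj (J A : InftyCat.{t}) : InftyCat.{t} :=
  (⟨(ihom J.toSSet).obj A.toSSet,
      have : Quasicategory A.toSSet := ObjectProperty.FullSubcategory.property A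
      inferInstance⟩ : QCat.{t})

theorem chosenTerminal_subsingleton {x y : (𝟙_ Cat.{t, t} : Cat.{t, t})} (θ θ' : x ⟶ y) :
    θ = θ' := by
  obtain ⟨⟨⟨θ⟩⟩⟩ := θ
  obtain ⟨⟨⟨θ'⟩⟩⟩ := θ'
  rfl

theorem ho_unit_subsingleton {x y : hoFunctor.obj (𝟙_ SSet.{t})} (θ θ' : x ⟶ y) :
    θ = θ' := by
  have h := bijective_of_isIso (inv (Functor.LaxMonoidal.ε hoFunctor.{t})) x y
  exact h.1 (chosenTerminal_subsingleton _ _)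

theorem ho_unit_obj {x y : hoFunctor.obj (𝟙_ SSet.{t})} : x = y :=
  (hoFunctor.obj.equiv _).injective (Subsingleton.elim (α := PUnit) _ _)

theorem heq_map {C D : Cat.{t, t}} (F : C ⟶ D) {x x' y y' : C} (hx : x = x') (hy : y = y')
    {θ : x ⟶ y} {θ' : x' ⟶ y'} (h : θ ≍ θ') : F.toFunctor.map θ ≍ F.toFunctor.map θ' := by
  subst hx hy; cases h; rfl

theorem heq_map_comp {S T U : SSet.{t}} (p : S ⟶ T) (q : T ⟶ U) (r : S ⟶ U) (hr : p ≫ q = r)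
    {x y : hoFunctor.obj S} (θ : x ⟶ y) :
    (hoFunctor.map r).toFunctor.map θ ≍
      (hoFunctor.map q).toFunctor.map ((hoFunctor.map p).toFunctor.map θ) := by
  subst hr
  rw [hoFunctor.map_comp]
  rfl

theorem heq_map_eqToHom {C D : Cat.{t, t}} (F : C ⟶ D) {x y : C} (e : x = y) (θ : x ⟶ y)
    (h : θ = eqToHom e) {z w : D} (e' : z = w) (hz : F.toFunctor.obj x = z) :
    F.toFunctor.map θ ≍ eqToHom e' := by
  subst e e' hz h
  simp

theorem isIso_toUnit (X : SSet.{t}) : IsIso (toUnit (sh X (𝟙_ SSet.{t}))) :=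
  ⟨eHomEquiv SSet (toUnit X), by ext n a; exact Functor.functorHom_ext fun c φ => by ext; rfl,
    toUnit_unique _ _⟩

theorem pt_sprod {X Y : InftyCat.{t}} (h : X ⟶ Y) (J : InftyCat.{t}) :
    pt (ofMap (mapSet h ▷ J.toSSet) : prodObj X J ⟶ prodObj Y J) =
      (hoFunctor.map (sprod X.toSSet J.toSSet Y.toSSet)).toFunctor.obj (pt h) := rfl

theorem sprod_fst (X J Y : SSet.{t}) : sprod X J Y ≫ post _ (fst Y J) = pre (fst X J) Y := rfl
theorem sprod_snd (X J Y : SSet.{t}) : sprod X J Y ≫ post _ (snd Y J) =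
  toUnit _ ≫ eHomEquiv SSet (snd X J) := rfl

noncomputable instance :  CartesianTwoCategory InftyCat.{t} where
  one := terminalObj
  toOne X := ofMap (toUnit X.toSSet)
  toOne_unique h := map_ext (toUnit_unique _ _)
  toOne_unique₂ {X h k} θ θ' := by
    have := isIso_toUnit X.toSSet
    have h₁ := bijective_of_isIso (hoFunctor.map (toUnit (sh X.toSSet (𝟙_ SSet.{t})))) (pt h) (pt k)
    exact (base_bijective h k).1 (h₁.1 (ho_unit_subsingleton _ _))
  prod := prodObj
  fst A B := ofMap (fst A.toSSet B.toSSet)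
  snd A B := ofMap (snd A.toSSet B.toSSet)
  pair_bijective X A B := by
    refine ⟨fun h k e => map_ext ?_, fun p => ⟨ofMap (CartesianMonoidalCategory.lift (mapSet p.1) (mapSet p.2)), ?_⟩⟩
    · apply CartesianMonoidalCategory.hom_ext
      · exact congrArg (fun z => mapSet z.1) e
      · exact congrArg (fun z => mapSet z.2) e
    · apply Prod.ext <;> apply map_ext
      · exact CartesianMonoidalCategory.lift_fst _ _
      · exact CartesianMonoidalCategory.lift_snd _ _
  pair₂_bijective {X A B} h k := by
    have := isIso_lift_ho X.toSSet A.toSSet B.toSSet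
    have h₁ := (bijective_of_isIso_lift (hoFunctor.map (post X.toSSet (fst A.toSSet B.toSSet)))
      (hoFunctor.map (post X.toSSet (snd A.toSSet B.toSSet))) (pt h) (pt k)).comp (base_bijective h k)
    have h₂ := ((bijective_conj (pt_post h (ofMap (fst A.toSSet B.toSSet) : prodObj A B ⟶ A))
       (pt_post k (ofMap (fst A.toSSet B.toSSet) : prodObj A B ⟶ A)).symm).prodMap
        (bijective_conj (pt_post h (ofMap (snd A.toSSet B.toSSet) : prodObj A B ⟶ B))
       (pt_post k (ofMap (snd A.toSSet B.toSSet) : prodObj A B ⟶ B)).symm)).comp h₁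
    have h₃ := (base_bijective (h ≫ (ofMap (fst A.toSSet B.toSSet) : prodObj A B ⟶ A))
       (k ≫ (ofMap (fst A.toSSet B.toSSet) : prodObj A B ⟶ A))).prodMap
       (base_bijective (h ≫ (ofMap (snd A.toSSet B.toSSet) : prodObj A B ⟶ B))
       (k ≫ (ofMap (snd A.toSSet B.toSSet) : prodObj A B ⟶ B)))
    refine (Function.Bijective.of_comp_iff' h₃ _).1 ?_
    convert h₂ using 1
    funext θ
    exact Prod.ext (base_post θ _) (base_post θ _)


theorem mapSet_prodMap {X Y : InftyCat.{t}} (h : X ⟶ Y) (J : InftyCat.{t}) :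
    CartesianTwoCategory.prodMap h J = (ofMap (mapSet h ▷ J.toSSet) : prodObj X J ⟶ prodObj Y J) := by
  apply CartesianTwoCategory.prod_hom_ext
  · exact CartesianTwoCategory.lift_fst _ _
  · exact CartesianTwoCategory.lift_snd _ _

theorem pt_prodMap {X Y : InftyCat.{t}} (h : X ⟶ Y) (J : InftyCat.{t}) :
    pt (CartesianTwoCategory.prodMap h J) =
      (hoFunctor.map (sprod X.toSSet J.toSSet Y.toSSet)).toFunctor.obj (pt h) := by
  rw [mapSet_prodMap]; rfl

theorem base_prodMap₂ {X Y : InftyCat.{t}} {h k : X ⟶ Y} (θ : h ⟶ k) (J : InftyCat.{t}) :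
    base (CartesianTwoCategory.prodMap₂ θ J) = eqToHom (pt_prodMap h J) ≫
      (hoFunctor.map (sprod X.toSSet J.toSSet Y.toSSet)).toFunctor.map (base θ) ≫
      eqToHom (pt_prodMap k J).symm := by
  obtain ⟨ω, hω⟩ := (base_bijective (CartesianTwoCategory.prodMap h J)
    (CartesianTwoCategory.prodMap k J)).2 (eqToHom (pt_prodMap h J) ≫
      (hoFunctor.map (sprod X.toSSet J.toSSet Y.toSSet)).toFunctor.map (base θ) ≫
      eqToHom (pt_prodMap k J).symm)
  rw [← hω]
  have hω' : base ω ≍ (hoFunctor.map (sprod X.toSSet J.toSSet Y.toSSet)).toFunctor.map (base θ) := by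
    rw [hω]; simp
  congr 1
  apply (CartesianTwoCategory.pair₂_bijective _ _).1
  apply Prod.ext
  · dsimp only
    rw [CartesianTwoCategory.prodMap₂_fst]
    apply (base_bijective _ _).1
    apply eq_of_heq
    refine HEq.trans ?_ (heq_base_post ω (ofMap (fst Y.toSSet J.toSSet) : prodObj Y J ⟶ Y)).symm
    refine HEq.trans ?_ (heq_map _ (pt_prodMap h J) (pt_prodMap k J) hω').symm
    refine HEq.trans ?_ (heq_map_comp _ _ _ (sprod_fst X.toSSet J.toSSet Y.toSSet) (base θ))
    refine HEq.trans ?_ (heq_base_pre (ofMap (fst X.toSSet J.toSSet) : prodObj X J ⟶ X) θ)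
    rw [base_comp, base_comp, base_eqToHom, base_eqToHom]
    simp
    rfl
  · dsimp only
    rw [CartesianTwoCategory.prodMap₂_snd]
    apply (base_bijective _ _).1
    apply eq_of_heq
    refine HEq.trans ?_ (heq_base_post ω (ofMap (snd Y.toSSet J.toSSet) : prodObj Y J ⟶ J)).symm
    refine HEq.trans ?_ (heq_map _ (pt_prodMap h J) (pt_prodMap k J) hω').symm
    refine HEq.trans ?_ (heq_map_comp _ _ _ (sprod_snd X.toSSet J.toSSet Y.toSSet) (base θ))
    refine HEq.trans ?_ (heq_map_comp _ _ _ rfl (base θ)).symm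
    rw [base_eqToHom]
    refine (heq_map_eqToHom _ ho_unit_obj _ (ho_unit_subsingleton _ _) _ ?_).symm
    rw [CartesianTwoCategory.prodMap_snd]
    rfl

theorem heq_base_prodMap₂ {X Y : InftyCat.{t}} {h k : X ⟶ Y} (θ : h ⟶ k) (J : InftyCat.{t}) :
    base (CartesianTwoCategory.prodMap₂ θ J) ≍
      (hoFunctor.map (sprod X.toSSet J.toSSet Y.toSSet)).toFunctor.map (base θ) := by
  rw [base_prodMap₂]; simp

theorem pt_injective {X Y : InftyCat.{t}} : Function.Injective (pt (X := X) (Y := Y)) :=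
  (CatEnrichedOrdinary.homEquiv (C := QCat.{t})).injective
theorem pt_surjective {X Y : InftyCat.{t}} : Function.Surjective (pt (X := X) (Y := Y)) :=
  (CatEnrichedOrdinary.homEquiv (C := QCat.{t})).surjective

theorem bijective_of_iso_ho {S T : SSet.{t}} (i : S ≅ T) :
    Function.Bijective (hoFunctor.map i.hom).toFunctor.obj :=
  Function.bijective_iff_has_inverse.2 ⟨(hoFunctor.map i.inv).toFunctor.obj,
    fun x => congrArg (fun F => Cat.Hom.toFunctor F |>.obj x) (hoFunctor.mapIso i).hom_inv_id,
    fun x => congrArg (fun F => Cat.Hom.toFunctor F |>.obj x) (hoFunctor.mapIso i).inv_hom_id⟩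

noncomputable instance : CartesianClosedTwoCategory InftyCat.{t} where
  exp := expObj
  ev J A := (ofMap (sev J.toSSet A.toSSet) : prodObj (expObj J A) J ⟶ A)
  curry_bijective X J A := by
    have h₁ := (bijective_of_iso_ho (expIso X.toSSet J.toSSet A.toSSet))
    constructor
    · intro h k e
      apply pt_injective
      apply h₁.1
      have := congrArg pt e
      dsimp only at this
      rw [pt_post, pt_post, pt_prodMap, pt_prodMap] at this
      simp only [expIso, Functor.map_comp]
      exact this
    · intro g
      obtain ⟨z, hz⟩ := h₁.2 (pt g)
      obtain ⟨h, rfl⟩ := pt_surjective (X := X) (Y := expObj J A) z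
      refine ⟨h, pt_injective ?_⟩
      rw [← hz, pt_post, pt_prodMap]
      simp only [expIso, Functor.map_comp]
      rfl
  curry₂_bijective {X J A} h k := by
    have h₁ := (bijective_of_isIso (hoFunctor.map (expIso X.toSSet J.toSSet A.toSSet).hom)
      (pt h) (pt k)).comp (base_bijective h k)
    have e : ∀ h : X ⟶ expObj J A, pt (CartesianTwoCategory.prodMap h J ≫
        (ofMap (sev J.toSSet A.toSSet) : prodObj (expObj J A) J ⟶ A)) =
        (hoFunctor.map (expIso X.toSSet J.toSSet A.toSSet).hom).toFunctor.obj (pt h) := by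
      intro h
      rw [pt_post, pt_prodMap]
      simp only [expIso, Functor.map_comp]
      rfl
    have h₂ := (bijective_conj (e h) (e k).symm).comp h₁
    refine (Function.Bijective.of_comp_iff' (base_bijective _ _) _).1 ?_
    convert h₂ using 1
    funext θ
    apply eq_of_heq
    refine (heq_base_post _ _).trans ?_
    refine (heq_map _ (pt_prodMap h J) (pt_prodMap k J) (heq_base_prodMap₂ θ J)).trans ?_
    refine (heq_map_comp _ _ _ rfl (base θ)).symm.trans ?_
    dsimp only [Function.comp_apply]
    simp
    rfl

end InftyCat

/-!
Exponentiation `(-)^J` is a 2-functor, so `f ⊣ u` induces `f^J ⊣ u^J`; and `Δ` is 2-natural, so the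
identity 2-cell `u^J Δ = Δ u` is the mate of the identity 2-cell `Δ f = f^J Δ`.

For limits, the counit of an adjunction exhibits its right adjoint as an absolute right lifting, and
absolute right liftings compose and cancel by pasting. Pasting `λ` with the counit of `f ⊣ u` gives
an absolute right lifting of `d` through `Δ f = f^J Δ`. The mate relation identifies it with the
pasting of `u^J λ` and the counit of `f^J ⊣ u^J`, and cancelling the latter proves the claim.
Colimits are dual, with units in place of counits.
-/

section AbsoluteLifting

variable {K : Type u} [Bicategory.{w, v} K] {A B A' B' C : K} {f : B ⟶ A} {u : A ⟶ B}
  {F : B' ⟶ A'} {U : A' ⟶ B'} {p : A ⟶ A'} {q : B ⟶ B'}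

theorem homEquiv₂_symm_mateEquiv (adj : f ⊣ u) (adj' : F ⊣ U) (τ : q ≫ F ⟶ f ≫ p) :
    adj'.homEquiv₂.symm (mateEquiv adj adj' τ) = (α_ u q F).hom ≫ adj.homEquiv₁ τ := by
  rw [Equiv.symm_apply_eq, mateEquiv_apply', Adjunction.homEquiv₁_apply,
    Adjunction.homEquiv₂_apply]
  bicategory

namespace IsAbsoluteRightLifting

theorem of_adjunction (adj : f ⊣ u) (g : C ⟶ A) :
    IsAbsoluteRightLifting f g (g ≫ u) ((α_ g u f).hom ≫ g ◁ adj.counit ≫ (ρ_ g).hom) := by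
  intro X b c
  convert ((α_ c g u).symm.homToEquiv.trans adj.homEquiv₂.symm).bijective using 1
  funext β
  simp [Adjunction.homEquiv₂_symm_apply]

theorem of_iso {f' : B ⟶ A} (e : f ≅ f') {g : C ⟶ A} {r : C ⟶ B} {ρ : r ≫ f ⟶ g}
    (hρ : IsAbsoluteRightLifting f g r ρ) : IsAbsoluteRightLifting f' g r (r ◁ e.inv ≫ ρ) := by
  intro X b c
  convert (whiskerLeftIso b e).homFromEquiv.bijective.comp (hρ b c) using 1
  funext β
  simp [whisker_exchange_assoc]

theorem comp_iff {g : C ⟶ A'} {r : C ⟶ A} {ρ : r ≫ p ⟶ g}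
    (hρ : IsAbsoluteRightLifting p g r ρ) {s : C ⟶ B} (σ : s ≫ f ⟶ r) :
    IsAbsoluteRightLifting (f ≫ p) g s ((α_ s f p).inv ≫ σ ▷ p ≫ ρ) ↔
      IsAbsoluteRightLifting f r s σ := by
  refine forall_congr' fun X => forall₂_congr fun b c => ?_
  have hpaste := (α_ b f p).homFromEquiv.bijective.comp (hρ (b ≫ f) c)
  rw [← Function.Bijective.of_comp_iff' hpaste (fun β => β ▷ f ≫ _)]
  refine iff_of_eq (congrArg _ (funext fun β => ?_))
  simp

theorem map_rightAdjoint (adj : f ⊣ u) (adj' : F ⊣ U) (τ : q ≫ F ≅ f ≫ p) {σ : u ≫ q ⟶ p ≫ U}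
    (hσ : mateEquiv adj adj' τ.hom = σ) {d : C ⟶ A'} {l : C ⟶ A} {lam : l ≫ p ⟶ d}
    (hl : IsAbsoluteRightLifting p d l lam) :
    IsAbsoluteRightLifting q (d ≫ U) (l ≫ u)
      ((α_ l u q).hom ≫ l ◁ σ ≫ (α_ l p U).inv ≫ lam ▷ U) := by
  have hcounit : σ ▷ F ≫ (α_ p U F).hom ≫ p ◁ adj'.counit ≫ (ρ_ p).hom =
      (α_ u q F).hom ≫ u ◁ τ.hom ≫ (α_ u f p).inv ≫ adj.counit ▷ p ≫ (λ_ p).hom := by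
    simpa only [Adjunction.homEquiv₁_apply, Adjunction.homEquiv₂_symm_apply, hσ] using
      homEquiv₂_symm_mateEquiv adj adj' τ.hom
  rw [← comp_iff (of_adjunction adj' d)]
  convert of_iso τ.symm ((comp_iff hl _).2 (of_adjunction adj l)) using 1
  calc
    _ = 𝟙 _ ⊗≫ l ◁ σ ▷ F ⊗≫ (lam ▷ (U ≫ F) ≫ d ◁ adj'.counit) ⊗≫ 𝟙 _ := by bicategory
    _ = 𝟙 _ ⊗≫ l ◁ (σ ▷ F ≫ (α_ p U F).hom ≫ p ◁ adj'.counit ≫ (ρ_ p).hom) ⊗≫ lam := by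
      rw [← whisker_exchange]; bicategory
    _ = _ := by rw [hcounit, Iso.symm_inv]; bicategory

end IsAbsoluteRightLifting

namespace IsAbsoluteLeftLifting

theorem of_adjunction (adj : f ⊣ u) (g : C ⟶ B) :
    IsAbsoluteLeftLifting u g (g ≫ f) ((ρ_ g).inv ≫ g ◁ adj.unit ≫ (α_ g f u).inv) := by
  intro X b c
  convert ((α_ c g f).symm.homFromEquiv.trans adj.homEquiv₂).bijective using 1
  funext β
  simp [Adjunction.homEquiv₂_apply]

theorem of_iso {f' : B ⟶ A} (e : f ≅ f') {g : C ⟶ A} {l : C ⟶ B} {γ : g ⟶ l ≫ f}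
    (hγ : IsAbsoluteLeftLifting f g l γ) : IsAbsoluteLeftLifting f' g l (γ ≫ l ◁ e.hom) := by
  intro X b c
  convert (whiskerLeftIso b e).homToEquiv.bijective.comp (hγ b c) using 1
  funext β
  simp [← whisker_exchange]

theorem comp_iff {g : C ⟶ A'} {l : C ⟶ A} {γ : g ⟶ l ≫ p}
    (hγ : IsAbsoluteLeftLifting p g l γ) {m : C ⟶ B} (δ : l ⟶ m ≫ f) :
    IsAbsoluteLeftLifting (f ≫ p) g m (γ ≫ δ ▷ p ≫ (α_ m f p).hom) ↔
      IsAbsoluteLeftLifting f l m δ := by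
  refine forall_congr' fun X => forall₂_congr fun b c => ?_
  have hpaste := (α_ b f p).homToEquiv.bijective.comp (hγ (b ≫ f) c)
  rw [← Function.Bijective.of_comp_iff' hpaste (fun β => c ◁ δ ≫ _)]
  refine iff_of_eq (congrArg _ (funext fun β => ?_))
  simp

theorem map_leftAdjoint (adj : f ⊣ u) (adj' : F ⊣ U) {τ : q ≫ F ⟶ f ≫ p} (σ : u ≫ q ≅ p ≫ U)
    (hτ : mateEquiv adj adj' τ = σ.hom) {d : C ⟶ B'} {c : C ⟶ B} {γ : d ⟶ c ≫ q}
    (hc : IsAbsoluteLeftLifting q d c γ) :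
    IsAbsoluteLeftLifting p (d ≫ F) (c ≫ f)
      (γ ▷ F ≫ (α_ c q F).hom ≫ c ◁ τ ≫ (α_ c f p).inv) := by
  have hunit : (λ_ q).inv ≫ adj.unit ▷ q ≫ (α_ f u q).hom ≫ f ◁ σ.hom =
      ((ρ_ q).inv ≫ q ◁ adj'.unit ≫ (α_ q F U).inv ≫ τ ▷ U) ≫ (α_ f p U).hom := by
    simpa only [Adjunction.homEquiv₁_symm_apply, Adjunction.homEquiv₂_apply] using
      (mateEquiv_eq_iff adj adj' τ σ.hom).1 hτ
  rw [← comp_iff (of_adjunction adj' d)]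
  convert of_iso σ ((comp_iff hc _).2 (of_adjunction adj c)) using 1
  calc
    _ = 𝟙 _ ⊗≫ (d ◁ adj'.unit ≫ γ ▷ (F ≫ U)) ⊗≫ c ◁ τ ▷ U ⊗≫ 𝟙 _ := by bicategory
    _ = γ ⊗≫ c ◁ (((ρ_ q).inv ≫ q ◁ adj'.unit ≫ (α_ q F U).inv ≫ τ ▷ U) ≫ (α_ f p U).hom) ⊗≫
          𝟙 _ := by
      rw [whisker_exchange]; bicategory
    _ = _ := by rw [← hunit]; bicategory

end IsAbsoluteLeftLifting

end AbsoluteLifting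

-- Equations between 2-cells that typecheck only up to strict equalities of 1-cells are stated as
-- equalities of functors between hom-categories: these compose without transports.
section StrictWhiskering

variable {K : Type u} [Bicategory.{w, v} K] [Bicategory.Strict K] {a b c : K}

theorem precomp_comp_precomp (f : a ⟶ b) (g : b ⟶ c) (d : K) :
    precomp d g ⋙ precomp d f = precomp d (f ≫ g) :=
  CategoryTheory.Functor.ext (fun h => (Strict.assoc f g h).symm) fun h k θ =>
    show f ◁ g ◁ θ =
        eqToHom (Strict.assoc f g h).symm ≫ (f ≫ g) ◁ θ ≫ eqToHom (Strict.assoc f g k) by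
      simp [Strict.associator_eqToIso]

theorem postcomp_comp_postcomp (d : K) (f : a ⟶ b) (g : b ⟶ c) :
    postcomp d f ⋙ postcomp d g = postcomp d (f ≫ g) :=
  CategoryTheory.Functor.ext (fun h => Strict.assoc h f g) fun h k θ =>
    show θ ▷ f ▷ g =
        eqToHom (Strict.assoc h f g) ≫ θ ▷ (f ≫ g) ≫ eqToHom (Strict.assoc k f g).symm by
      simp [Strict.associator_eqToIso]

theorem precomp_comp_postcomp {d : K} (f : a ⟶ b) (g : c ⟶ d) :
    precomp c f ⋙ postcomp a g = postcomp b g ⋙ precomp d f :=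
  CategoryTheory.Functor.ext (fun h => Strict.assoc f h g) fun h k θ =>
    show (f ◁ θ) ▷ g =
        eqToHom (Strict.assoc f h g) ≫ f ◁ (θ ▷ g) ≫ eqToHom (Strict.assoc f k g).symm by
      simp [Strict.associator_eqToIso]

end StrictWhiskering

namespace CartesianTwoCategory

variable {K : Type u} [Bicategory.{w, v} K] [Bicategory.Strict K] [CartesianTwoCategory K]
  {X Y Z A B : K}

theorem prod_hom_ext₂ {h k : X ⟶ prod A B} {θ θ' : h ⟶ k}
    (h₁ : θ ▷ fst A B = θ' ▷ fst A B) (h₂ : θ ▷ snd A B = θ' ▷ snd A B) : θ = θ' :=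
  (pair₂_bijective h k).1 (Prod.ext h₁ h₂)

theorem prod_functor_ext {D : Type*} [Category* D] {G H : D ⥤ (X ⟶ prod A B)}
    (h₁ : G ⋙ postcomp X (fst A B) = H ⋙ postcomp X (fst A B))
    (h₂ : G ⋙ postcomp X (snd A B) = H ⋙ postcomp X (snd A B)) : G = H := by
  refine CategoryTheory.Functor.ext
    (fun d => prod_hom_ext (Functor.congr_obj h₁ d) (Functor.congr_obj h₂ d)) fun d e θ => ?_
  apply prod_hom_ext₂
  · change (postcomp X (fst A B)).map _ = (postcomp X (fst A B)).map _
    simp only [Functor.map_comp, eqToHom_map]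
    exact Functor.congr_hom h₁ θ
  · change (postcomp X (snd A B)).map _ = (postcomp X (snd A B)).map _
    simp only [Functor.map_comp, eqToHom_map]
    exact Functor.congr_hom h₂ θ

theorem prodMap_id (X J : K) : prodMap (𝟙 X) J = 𝟙 (prod X J) := by
  apply prod_hom_ext
  · rw [prodMap_fst, Strict.comp_id, Strict.id_comp]
  · rw [prodMap_snd, Strict.id_comp]

/-- The functor `- × J` between hom-categories. -/
noncomputable def prodMapFunctor (X Y J : K) : (X ⟶ Y) ⥤ (prod X J ⟶ prod Y J) where
  obj h := prodMap h J
  map θ := prodMap₂ θ J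
  map_id h := prod_hom_ext₂ (by simp [prodMap₂_fst]) (by simp [prodMap₂_snd])
  map_comp θ θ' := prod_hom_ext₂ (by simp [prodMap₂_fst]) (by simp [prodMap₂_snd])

theorem prodMapFunctor_comp_postcomp_fst (X Y J : K) :
    prodMapFunctor X Y J ⋙ postcomp (prod X J) (fst Y J) = precomp Y (fst X J) :=
  CategoryTheory.Functor.ext (fun h => prodMap_fst h J) fun _ _ θ => prodMap₂_fst θ J

theorem prodMapFunctor_comp_postcomp_snd (X Y J : K) :
    prodMapFunctor X Y J ⋙ postcomp (prod X J) (snd Y J) = (Functor.const _).obj (snd X J) :=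
  CategoryTheory.Functor.ext (fun h => prodMap_snd h J) fun h k θ =>
    show prodMap₂ θ J ▷ snd Y J =
        eqToHom (prodMap_snd h J) ≫ 𝟙 _ ≫ eqToHom (prodMap_snd k J).symm by
      simp [prodMap₂_snd]

theorem precomp_comp_prodMapFunctor (f : X ⟶ Y) (Z J : K) :
    precomp Z f ⋙ prodMapFunctor X Z J =
      prodMapFunctor Y Z J ⋙ precomp (prod Z J) (prodMap f J) := by
  apply prod_functor_ext
  · calc
      precomp Z f ⋙ prodMapFunctor X Z J ⋙ postcomp _ (fst Z J)
        = precomp Z f ⋙ precomp Z (fst X J) := by rw [prodMapFunctor_comp_postcomp_fst]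
      _ = precomp Z (fst Y J) ⋙ precomp Z (prodMap f J) := by
        rw [precomp_comp_precomp, precomp_comp_precomp, prodMap_fst]
      _ = prodMapFunctor Y Z J ⋙ postcomp _ (fst Z J) ⋙ precomp Z (prodMap f J) := by
        rw [← prodMapFunctor_comp_postcomp_fst, Functor.assoc]
      _ = prodMapFunctor Y Z J ⋙ precomp _ (prodMap f J) ⋙ postcomp _ (fst Z J) := by
        rw [precomp_comp_postcomp]
  · calc
      precomp Z f ⋙ prodMapFunctor X Z J ⋙ postcomp _ (snd Z J)
        = (Functor.const _).obj (snd X J) := by rw [prodMapFunctor_comp_postcomp_snd]; rfl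
      _ = (Functor.const _).obj (snd Y J) ⋙ precomp J (prodMap f J) :=
        CategoryTheory.Functor.ext (fun _ => (prodMap_snd f J).symm) fun _ _ _ =>
          show 𝟙 (snd X J) = eqToHom (prodMap_snd f J).symm ≫ prodMap f J ◁ 𝟙 (snd Y J) ≫
            eqToHom (prodMap_snd f J) by simp
      _ = prodMapFunctor Y Z J ⋙ postcomp _ (snd Z J) ⋙ precomp J (prodMap f J) := by
        rw [← prodMapFunctor_comp_postcomp_snd, Functor.assoc]
      _ = prodMapFunctor Y Z J ⋙ precomp _ (prodMap f J) ⋙ postcomp _ (snd Z J) := by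
        rw [precomp_comp_postcomp]

theorem postcomp_comp_prodMapFunctor (X : K) (g : Y ⟶ Z) (J : K) :
    postcomp X g ⋙ prodMapFunctor X Z J =
      prodMapFunctor X Y J ⋙ postcomp (prod X J) (prodMap g J) := by
  apply prod_functor_ext
  · calc
      postcomp X g ⋙ prodMapFunctor X Z J ⋙ postcomp _ (fst Z J)
        = postcomp X g ⋙ precomp Z (fst X J) := by rw [prodMapFunctor_comp_postcomp_fst]
      _ = precomp Y (fst X J) ⋙ postcomp _ g := (precomp_comp_postcomp _ _).symm
      _ = prodMapFunctor X Y J ⋙ postcomp _ (fst Y J) ⋙ postcomp _ g := by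
        rw [← prodMapFunctor_comp_postcomp_fst, Functor.assoc]
      _ = prodMapFunctor X Y J ⋙ postcomp _ (prodMap g J) ⋙ postcomp _ (fst Z J) := by
        rw [postcomp_comp_postcomp, postcomp_comp_postcomp, prodMap_fst]
  · calc
      postcomp X g ⋙ prodMapFunctor X Z J ⋙ postcomp _ (snd Z J)
        = (Functor.const _).obj (snd X J) := by rw [prodMapFunctor_comp_postcomp_snd]; rfl
      _ = prodMapFunctor X Y J ⋙ postcomp _ (snd Y J) :=
        (prodMapFunctor_comp_postcomp_snd X Y J).symm
      _ = prodMapFunctor X Y J ⋙ postcomp _ (prodMap g J) ⋙ postcomp _ (snd Z J) := by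
        rw [postcomp_comp_postcomp, prodMap_snd]

end CartesianTwoCategory

namespace CartesianClosedTwoCategory

open CartesianTwoCategory

variable {K : Type u} [Bicategory.{w, v} K] [Bicategory.Strict K] [CartesianClosedTwoCategory K]
  {X Y J A B C : K}

/-- The canonical functor `h ↦ ev ∘ (h × J)`, one half of the exponential isomorphism of
hom-categories. -/
noncomputable def uncurryFunctor (X J A : K) : (X ⟶ exp J A) ⥤ (prod X J ⟶ A) :=
  prodMapFunctor X (exp J A) J ⋙ postcomp (prod X J) (ev J A)

instance : (uncurryFunctor X J A).Faithful where
  map_injective h := (curry₂_bijective _ _).1 h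

instance : (uncurryFunctor X J A).Full where
  map_surjective := (curry₂_bijective _ _).2

theorem exp_functor_ext {D : Type*} [Category* D] {G H : D ⥤ (X ⟶ exp J A)}
    (h : G ⋙ uncurryFunctor X J A = H ⋙ uncurryFunctor X J A) : G = H :=
  CategoryTheory.Functor.ext (fun d => exp_hom_ext (Functor.congr_obj h d))
    fun _ _ θ => (uncurryFunctor X J A).map_injective <| by
      simpa [eqToHom_map] using Functor.congr_hom h θ

theorem uncurryFunctor_obj_curry (g : prod X J ⟶ A) : (uncurryFunctor X J A).obj (curry g) = g :=
  prodMap_curry_ev g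

/-- Transposition as a functor. Its action on 2-cells comes from full faithfulness of
`uncurryFunctor`, the `eqToHom`s accounting for `uncurryFunctor.obj (curry g) = g` being only a
propositional equality. -/
noncomputable def curryFunctor (X J A : K) : (prod X J ⟶ A) ⥤ (X ⟶ exp J A) where
  obj := curry
  map {g g'} θ := (uncurryFunctor X J A).preimage
    (eqToHom (uncurryFunctor_obj_curry g) ≫ θ ≫ eqToHom (uncurryFunctor_obj_curry g').symm)
  map_id g := (uncurryFunctor X J A).map_injective (by simp)
  map_comp θ θ' := (uncurryFunctor X J A).map_injective (by simp)

theorem curryFunctor_comp_uncurryFunctor (X J A : K) :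
    curryFunctor X J A ⋙ uncurryFunctor X J A = 𝟭 _ :=
  CategoryTheory.Functor.ext uncurryFunctor_obj_curry (by simp [curryFunctor])

theorem precomp_comp_uncurryFunctor (f : X ⟶ Y) (J A : K) :
    precomp (exp J A) f ⋙ uncurryFunctor X J A =
      uncurryFunctor Y J A ⋙ precomp A (prodMap f J) := by
  rw [uncurryFunctor, ← Functor.assoc, precomp_comp_prodMapFunctor, Functor.assoc,
    precomp_comp_postcomp, ← Functor.assoc, uncurryFunctor]

theorem postcomp_comp_uncurryFunctor (X : K) (g : Y ⟶ exp J A) :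
    postcomp X g ⋙ uncurryFunctor X J A =
      prodMapFunctor X Y J ⋙ postcomp (prod X J) (prodMap g J ≫ ev J A) := by
  rw [uncurryFunctor, ← Functor.assoc, postcomp_comp_prodMapFunctor, Functor.assoc,
    postcomp_comp_postcomp]

theorem prodMap_expMap_ev (u : A ⟶ B) (J : K) : prodMap (expMap u J) J ≫ ev J B = ev J A ≫ u :=
  prodMap_curry_ev _

theorem prodMap_constDiagram_ev (A J : K) : prodMap (constDiagram A J) J ≫ ev J A = fst A J := by
  rw [constDiagram_eq, prodMap_curry_ev]

/-- The exponentiation functor `u ↦ u^J` between hom-categories; on 1-cells it is `expMap`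
definitionally. -/
noncomputable def expMapFunctor (A B J : K) : (A ⟶ B) ⥤ (exp J A ⟶ exp J B) :=
  precomp B (ev J A) ⋙ curryFunctor (exp J A) J B

theorem expMapFunctor_comp_uncurryFunctor (A B J : K) :
    expMapFunctor A B J ⋙ uncurryFunctor (exp J A) J B = precomp B (ev J A) := by
  rw [expMapFunctor, Functor.assoc, curryFunctor_comp_uncurryFunctor, Functor.comp_id]

theorem precomp_comp_expMapFunctor (u : A ⟶ B) (C J : K) :
    precomp C u ⋙ expMapFunctor A C J =
      expMapFunctor B C J ⋙ precomp (exp J C) (expMap u J) := by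
  apply exp_functor_ext
  calc
    precomp C u ⋙ expMapFunctor A C J ⋙ uncurryFunctor _ J C
      = precomp C u ⋙ precomp C (ev J A) := by rw [expMapFunctor_comp_uncurryFunctor]
    _ = precomp C (ev J B) ⋙ precomp C (prodMap (expMap u J) J) := by
      rw [precomp_comp_precomp, precomp_comp_precomp, prodMap_expMap_ev]
    _ = expMapFunctor B C J ⋙ uncurryFunctor _ J C ⋙ precomp C (prodMap (expMap u J) J) := by
      rw [← expMapFunctor_comp_uncurryFunctor, Functor.assoc]
    _ = expMapFunctor B C J ⋙ precomp _ (expMap u J) ⋙ uncurryFunctor _ J C := by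
      rw [precomp_comp_uncurryFunctor]

theorem postcomp_comp_expMapFunctor (A : K) (u : B ⟶ C) (J : K) :
    postcomp A u ⋙ expMapFunctor A C J =
      expMapFunctor A B J ⋙ postcomp (exp J A) (expMap u J) := by
  apply exp_functor_ext
  calc
    postcomp A u ⋙ expMapFunctor A C J ⋙ uncurryFunctor _ J C
      = postcomp A u ⋙ precomp C (ev J A) := by rw [expMapFunctor_comp_uncurryFunctor]
    _ = precomp B (ev J A) ⋙ postcomp _ u := (precomp_comp_postcomp _ _).symm
    _ = expMapFunctor A B J ⋙ uncurryFunctor _ J B ⋙ postcomp _ u := by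
      rw [← expMapFunctor_comp_uncurryFunctor, Functor.assoc]
    _ = expMapFunctor A B J ⋙ prodMapFunctor _ _ J ⋙ postcomp _ (ev J B ≫ u) := by
      rw [uncurryFunctor, Functor.assoc, postcomp_comp_postcomp]
    _ = expMapFunctor A B J ⋙ postcomp _ (expMap u J) ⋙ uncurryFunctor _ J C := by
      rw [postcomp_comp_uncurryFunctor, prodMap_expMap_ev]

theorem expMapFunctor_comp_precomp_constDiagram (A B J : K) :
    expMapFunctor A B J ⋙ precomp (exp J B) (constDiagram A J) =
      postcomp A (constDiagram B J) := by
  apply exp_functor_ext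
  calc
    expMapFunctor A B J ⋙ precomp _ (constDiagram A J) ⋙ uncurryFunctor A J B
      = expMapFunctor A B J ⋙ uncurryFunctor _ J B ⋙ precomp B (prodMap (constDiagram A J) J) := by
      rw [precomp_comp_uncurryFunctor]
    _ = precomp B (ev J A) ⋙ precomp B (prodMap (constDiagram A J) J) := by
      rw [← Functor.assoc, expMapFunctor_comp_uncurryFunctor]
    _ = precomp B (fst A J) := by rw [precomp_comp_precomp, prodMap_constDiagram_ev]
    _ = prodMapFunctor A B J ⋙ postcomp _ (fst B J) :=
      (prodMapFunctor_comp_postcomp_fst A B J).symm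
    _ = postcomp A (constDiagram B J) ⋙ uncurryFunctor A J B := by
      rw [postcomp_comp_uncurryFunctor, prodMap_constDiagram_ev]

theorem expMap_id (A J : K) : expMap (𝟙 A) J = 𝟙 (exp J A) := by
  apply exp_hom_ext
  rw [prodMap_expMap_ev, prodMap_id, Strict.comp_id, Strict.id_comp]

theorem expMap_comp (u : A ⟶ B) (v : B ⟶ C) (J : K) :
    expMap (u ≫ v) J = expMap u J ≫ expMap v J :=
  Functor.congr_obj (precomp_comp_expMapFunctor u C J) v

/-- The 2-cell `θ^J : u^J ⇒ v^J`. -/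
noncomputable def expMap₂ {u v : A ⟶ B} (θ : u ⟶ v) (J : K) : expMap u J ⟶ expMap v J :=
  (expMapFunctor A B J).map θ

theorem constDiagram_whiskerLeft_expMap₂ {u v : A ⟶ B} (θ : u ⟶ v) (J : K) :
    constDiagram A J ◁ expMap₂ θ J =
      eqToHom (comp_constDiagram u J).symm ≫ θ ▷ constDiagram B J ≫
        eqToHom (comp_constDiagram v J) :=
  Functor.congr_hom (expMapFunctor_comp_precomp_constDiagram A B J) θ

/-- The 2-functor `(-)^J`. -/
noncomputable def expPseudofunctor (J : K) : StrictPseudofunctor K K :=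
  .mk''
    { PrelaxFunctor.mkOfHomFunctors (exp J) (fun A B => expMapFunctor A B J) with
      map_id A := expMap_id A J
      map_comp u v := expMap_comp u v J
      map₂_whisker_left u _ _ θ := Functor.congr_hom (precomp_comp_expMapFunctor u _ J) θ
      map₂_whisker_right θ w := Functor.congr_hom (postcomp_comp_expMapFunctor _ w J) θ }

/-- The adjunction `f^J ⊣ u^J` obtained by applying the 2-functor `(-)^J` to `f ⊣ u`. -/
noncomputable def expAdjunction {f : B ⟶ A} {u : A ⟶ B} (adj : f ⊣ u) (J : K) :
    expMap f J ⊣ expMap u J :=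
  (expPseudofunctor J).mapAdjunction adj

theorem expAdjunction_unit {f : B ⟶ A} {u : A ⟶ B} (adj : f ⊣ u) (J : K) :
    (expAdjunction adj J).unit =
      eqToHom (expMap_id B J).symm ≫ expMap₂ adj.unit J ≫ eqToHom (expMap_comp f u J) :=
  (expPseudofunctor J).mapAdjunction_unit' adj

theorem mateEquiv_constDiagram {f : B ⟶ A} {u : A ⟶ B} (adj : f ⊣ u) (J : K) :
    mateEquiv adj (expAdjunction adj J) (eqToHom (comp_constDiagram f J).symm) =
      eqToHom (comp_constDiagram u J) := by
  rw [mateEquiv_eq_iff, Adjunction.homEquiv₁_symm_apply, Adjunction.homEquiv₂_apply,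
    expAdjunction_unit]
  simp [constDiagram_whiskerLeft_expMap₂, Strict.associator_eqToIso, Strict.leftUnitor_eqToIso,
    Strict.rightUnitor_eqToIso]

theorem preservesLimitCones_of_adjunction {f : B ⟶ A} {u : A ⟶ B} (adj : f ⊣ u) :
    PreservesLimitCones u := fun J _ _ _ hl =>
  hl.map_rightAdjoint adj (expAdjunction adj J) (eqToIso (comp_constDiagram f J).symm)
    (mateEquiv_constDiagram adj J)

theorem preservesColimitCones_of_adjunction {f : B ⟶ A} {u : A ⟶ B} (adj : f ⊣ u) :
    PreservesColimitCones f := fun J _ _ _ hc =>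
  hc.map_leftAdjoint adj (expAdjunction adj J) (eqToIso (comp_constDiagram u J))
    (mateEquiv_constDiagram adj J)

end CartesianClosedTwoCategory

theorem mainTheorem1 :
    (∀ (K : Type u) [Bicategory.{w, v} K] [Bicategory.Strict K] [CartesianClosedTwoCategory K]
      {A B : K} (f : B ⟶ A) (u : A ⟶ B), (f ⊣ u) →
        CartesianClosedTwoCategory.PreservesLimitCones u ∧
          CartesianClosedTwoCategory.PreservesColimitCones f) ∧
    (∀ {A B : InftyCat.{t}} (f : B ⟶ A) (u : A ⟶ B), (f ⊣ u) →
        CartesianClosedTwoCategory.PreservesLimitCones u ∧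
          CartesianClosedTwoCategory.PreservesColimitCones f) := by
  refine ⟨fun K _ _ _ A B f u adj => ?_, fun f u adj => ?_⟩
  all_goals exact ⟨CartesianClosedTwoCategory.preservesLimitCones_of_adjunction adj,
    CartesianClosedTwoCategory.preservesColimitCones_of_adjunction adj⟩
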